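/- There is a universal constant $C > 0$ with the following property. Let $(\Omega, \mathcal{F}, \mathbb{P})$ be any probability space, $\xi$ a standard normal random variable on it, and $\{\xi_{n,k}\}_{n \geq 1,\, 1 \leq k \leq n}$ a standard triangular array of real random variables on it; that is, for every $n \geq 1$ the variables $\xi_{n,1}, \ldots, \xi_{n,n}$ are independent, $\mathbb{E}[\xi_{n,k}] = 0$ for $1 \leq k \leq n$, and $\sum_{k=1}^n \mathbb{E}[\xi_{n,k}^2] = 1$. Then $$\limsup_{n \to \infty} K\left(\xi, \sum_{k=1}^n \xi_{n,k}\right) \leq C \, \mathrm{Lin}(\{\xi_{n,k}\}),$$ where $K(\eta, \eta') = \sup_{x \in \mathbb{R}} \left| \mathbb{P}[\eta \leq x] - \mathbb{P}[\eta' \leq x] \right|$ is the Kolmogorov distance and $$\mathrm{Lin}(\{\xi_{n,k}\}) = \sup_{\epsilon > 0} \limsup_{n \to \infty} \sum_{k=1}^n \mathbb{E}\left[\xi_{n,k}^2 ; |\xi_{n,k}| > \epsilon\right]$$ is the Lindeberg index, with $\mathbb{E}[Y ; A]$ denoting $\mathbb{E}[Y \mathbf{1}_A]$. -/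

import Mathlib

open MeasureTheory ProbabilityTheory Filter

noncomputable section

/-- A standard triangular array on the probability space `(Ω, P)`. Row `n ≥ 1` consists of the `n`
random variables `X n k`, `k : Fin n`; they are independent and centred, have finite second moments,
and their second moments add up to `1`. The empty row `n = 0` carries no condition. -/
structure IsStandardTriangularArray {Ω : Type*} [MeasurableSpace Ω] (P : Measure Ω)
    (X : (n : ℕ) → Fin n → Ω → ℝ) : Prop where
  measurable : ∀ (n : ℕ) (k : Fin n), Measurable (X n k)
  memLp_two : ∀ (n : ℕ) (k : Fin n), MemLp (X n k) 2 P
  indep : ∀ n : ℕ, 1 ≤ n → iIndepFun (X n) P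
  mean_zero : ∀ (n : ℕ) (k : Fin n), ∫ ω, X n k ω ∂P = 0
  sum_second_moment : ∀ n : ℕ, 1 ≤ n → ∑ k : Fin n, ∫ ω, (X n k ω) ^ 2 ∂P = 1

/-- The row-wise sum of the `n`-th row. -/
def rowSum {Ω : Type*} (X : (n : ℕ) → Fin n → Ω → ℝ) (n : ℕ) : Ω → ℝ :=
  fun ω => ∑ k : Fin n, X n k ω

/-- The Kolmogorov distance between two real random variables: the supremum over all real `x` of
`|P[η ≤ x] - P[η' ≤ x]|`. -/
def kolmogorovDist {Ω : Type*} [MeasurableSpace Ω] (P : Measure Ω) (η η' : Ω → ℝ) : ℝ :=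
  ⨆ x : ℝ, |P.real {ω | η ω ≤ x} - P.real {ω | η' ω ≤ x}|

/-- The limes superior, as `n → ∞`, of the Kolmogorov distance between `ξ` and the row-wise sums. -/
def lambdaK {Ω : Type*} [MeasurableSpace Ω] (P : Measure Ω)
    (X : (n : ℕ) → Fin n → Ω → ℝ) (ξ : Ω → ℝ) : ℝ :=
  limsup (fun n : ℕ => kolmogorovDist P ξ (rowSum X n)) atTop

/-- The sum over the `n`-th row of the truncated second moments `E[X² ; |X| > ε]`. -/
def lindebergSum {Ω : Type*} [MeasurableSpace Ω] (P : Measure Ω)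
    (X : (n : ℕ) → Fin n → Ω → ℝ) (ε : ℝ) (n : ℕ) : ℝ :=
  ∑ k : Fin n, ∫ ω in {ω | ε < |X n k ω|}, (X n k ω) ^ 2 ∂P

/-- The Lindeberg index: the supremum over all `ε > 0` of the limes superior of the Lindeberg
sums. -/
def lindebergIndex {Ω : Type*} [MeasurableSpace Ω] (P : Measure Ω)
    (X : (n : ℕ) → Fin n → Ω → ℝ) : ℝ :=
  ⨆ ε : {ε : ℝ // 0 < ε}, limsup (fun n : ℕ => lindebergSum P X ε n) atTop

end

/-! The proof is Stein's method combined with a concentration inequality. Let `W` be the sum of a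
row, `h` a ramp of width `ε` replacing the indicator of `Iic x`, and `f` the bounded solution of `f'
w = w * f w + h w - 𝔼 h`. Then `𝔼 h(W)` minus the Gaussian mean of `h` equals `𝔼 f'(W) - 𝔼 W f(W)`.
Writing `W = Z + X k` with `Z` independent of `X k`, a Taylor expansion of `f` around `Z` bounds
this difference by the Lindeberg sum `L` at level `ε`, plus the mean oscillation of `f'` on the
scale `ε`.

The bounds on `f` and `w * f w` do not depend on `h`, so `w * f w` contributes `O(ε)` to that
oscillation. The ramp has slope `1/ε`, but a shift by at most `ε` changes `h` by at most `1`, and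
only at points within `2ε` of `x`. What remains is the probability that `Z` lies there, and the
concentration inequality `measureReal_abs_sum_sub_le` shows that it is `O(ε + L)`. No factor `1/ε`
survives.

Hence the Kolmogorov distance is at most `14 L + C ε` (`exists_abs_measureReal_sub_le`). Letting `n
→ ∞` and then `ε → 0` leaves `14` times the Lindeberg index. -/

/-! ### Stein's equation for the standard normal law -/

lemma integrable_exp_neg_sq_half : Integrable (fun y : ℝ => Real.exp (-y ^ 2 / 2)) := by
  have h := integrable_exp_neg_mul_sq (b := 1 / 2) (by norm_num)
  refine h.congr (Eventually.of_forall fun y => ?_)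
  ring_nf

/-- Mills ratio bound: on the domain of integration `w ≤ y`, and `y * exp (-y ^ 2 / 2)` has an
explicit antiderivative. -/
lemma mul_integral_Ioi_exp_neg_sq_half_le {w : ℝ} (hw : 0 ≤ w) :
    w * ∫ y in Set.Ioi w, Real.exp (-y ^ 2 / 2) ≤ Real.exp (-w ^ 2 / 2) := by
  have hderiv : ∀ y : ℝ, HasDerivAt (fun y : ℝ => -Real.exp (-y ^ 2 / 2))
      (y * Real.exp (-y ^ 2 / 2)) y := by
    intro y
    have h1 : HasDerivAt (fun y : ℝ => -y ^ 2 / 2) (-y) y := by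
      have := ((hasDerivAt_pow 2 y).neg).div_const 2
      exact this.congr_deriv (by norm_num; ring)
    exact h1.exp.neg.congr_deriv (by ring)
  have hlim : Tendsto (fun y : ℝ => -Real.exp (-y ^ 2 / 2)) atTop (nhds 0) := by
    rw [← neg_zero]
    refine Tendsto.neg (Real.tendsto_exp_atBot.comp ?_)
    have : Tendsto (fun y : ℝ => y ^ 2 / 2) atTop atTop :=
      (tendsto_pow_atTop two_ne_zero).atTop_div_const (by norm_num)
    refine (tendsto_neg_atTop_atBot.comp this).congr fun y => ?_
    simp only [Function.comp]
    ring
  have hpos : ∀ y ∈ Set.Ioi w, 0 ≤ y * Real.exp (-y ^ 2 / 2) := fun y hy =>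
    mul_nonneg (hw.trans (le_of_lt hy)) (Real.exp_pos _).le
  have hint : IntegrableOn (fun y : ℝ => y * Real.exp (-y ^ 2 / 2)) (Set.Ioi w) :=
    integrableOn_Ioi_deriv_of_nonneg' (fun y _ => hderiv y) hpos hlim
  have hval := integral_Ioi_of_hasDerivAt_of_tendsto' (fun y _ => hderiv y) hint hlim
  rw [← integral_const_mul]
  calc ∫ y in Set.Ioi w, w * Real.exp (-y ^ 2 / 2)
      ≤ ∫ y in Set.Ioi w, y * Real.exp (-y ^ 2 / 2) :=
        setIntegral_mono_on (integrable_exp_neg_sq_half.integrableOn.const_mul w) hint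
          measurableSet_Ioi fun y hy => by
            have : w ≤ y := le_of_lt hy
            gcongr
    _ = Real.exp (-w ^ 2 / 2) := by rw [hval]; ring

/-- Solution of the Stein equation `f' w = w * f w + h w - 𝔼 h`, with bounds uniform in `h`. -/
lemma exists_stein_solution : ∃ C : ℝ, 0 ≤ C ∧ ∀ h : ℝ → ℝ, Continuous h →
    (∀ y, 0 ≤ h y) → (∀ y, h y ≤ 1) →
    ∃ f : ℝ → ℝ, (∀ w, HasDerivAt f (w * f w + h w - ∫ y, h y ∂(gaussianReal 0 1)) w) ∧
      (∀ w, |f w| ≤ C) ∧ ∀ w, |w * f w| ≤ 1 := by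
  have hI0 : 0 ≤ ∫ y : ℝ, Real.exp (-y ^ 2 / 2) := integral_nonneg fun y => (Real.exp_pos _).le
  -- The first term bounds `f` on `|w| ≤ 1`; the summand `1` covers `|w| ≥ 1`, where `|f w| ≤ |w * f
  -- w| ≤ 1`.
  refine ⟨Real.exp (1 / 2) * (∫ y : ℝ, Real.exp (-y ^ 2 / 2)) + 1, by positivity, ?_⟩
  intro h hc h0 h1
  have hhb : ∀ y, ‖h y‖ ≤ 1 := fun y => by
    rw [Real.norm_eq_abs, abs_of_nonneg (h0 y)]; exact h1 y
  have hhi : Integrable h (gaussianReal 0 1) :=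
    Integrable.of_bound hc.aestronglyMeasurable 1 (Eventually.of_forall hhb)
  set c := ∫ y, h y ∂(gaussianReal 0 1) with hcdef
  have hc0 : 0 ≤ c := integral_nonneg h0
  have hc1 : c ≤ 1 := by
    have := integral_mono hhi (integrable_const (1 : ℝ)) h1
    simpa using this
  set e : ℝ → ℝ := fun y => Real.exp (-y ^ 2 / 2) with he
  have hei : Integrable e := integrable_exp_neg_sq_half
  set u : ℝ → ℝ := fun y => (h y - c) * e y with hu
  have hucont : Continuous u := by
    simp only [hu, he]; fun_prop
  have hub : ∀ y, ‖u y‖ ≤ e y := fun y => by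
    have : |h y - c| ≤ 1 := abs_le.2 ⟨by linarith [h0 y], by linarith [h1 y]⟩
    simp only [hu, Real.norm_eq_abs, abs_mul]
    rw [abs_of_nonneg (Real.exp_pos _ : 0 < e y).le]
    exact mul_le_of_le_one_left (Real.exp_pos _).le this
  have hui : Integrable u := hei.mono' hucont.aestronglyMeasurable (Eventually.of_forall hub)
  -- Centring `h` at its Gaussian mean makes the total integral vanish, so `F` is also minus an
  -- upper tail. Each half-line can then use the tail on its own side, which keeps `exp (w ^ 2 / 2)
  -- * F w` bounded.
  have huzero : ∫ y, u y = 0 := by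
    have hsub : ∫ y, (h y - c) ∂(gaussianReal 0 1) = 0 := by
      rw [integral_sub hhi (integrable_const _)]
      simp [hcdef]
    rw [integral_gaussianReal_eq_integral_smul one_ne_zero] at hsub
    have hrw : (fun y => gaussianPDFReal 0 1 y • (h y - c))
        = fun y => (Real.sqrt (2 * Real.pi))⁻¹ * u y := by
      funext y
      simp only [gaussianPDFReal, hu, he, smul_eq_mul]
      simp
      ring
    rw [hrw, integral_const_mul] at hsub
    refine (mul_eq_zero.1 hsub).resolve_left ?_
    positivity
  set F : ℝ → ℝ := fun w => ∫ y in Set.Iic w, u y with hF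
  have hFd : ∀ w, HasDerivAt F (u w) w := by
    intro w
    have heq : F = fun w => (∫ y in Set.Iic 0, u y) + ∫ y in (0 : ℝ)..w, u y := by
      funext w
      rw [← intervalIntegral.integral_Iic_sub_Iic hui.integrableOn hui.integrableOn]
      simp [hF]
    rw [heq]
    exact (intervalIntegral.integral_hasDerivAt_right hui.intervalIntegrable
      (hucont.stronglyMeasurableAtFilter _ _) hucont.continuousAt).const_add _
  have hFneg : ∀ w, F w = -∫ y in Set.Ioi w, u y := by
    intro w
    have := intervalIntegral.integral_Iic_add_Ioi (b := w) hui.integrableOn hui.integrableOn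
    rw [huzero] at this
    simp only [hF]
    linarith
  have hFb : ∀ w, |F w| ≤ ∫ y, e y := by
    intro w
    calc |F w| ≤ ∫ y in Set.Iic w, e y :=
          norm_integral_le_of_norm_le hei.integrableOn (Eventually.of_forall hub)
      _ ≤ ∫ y, e y := setIntegral_le_integral hei (Eventually.of_forall fun y => (Real.exp_pos _).le)
  have hFw : ∀ w, |w| * |F w| ≤ e w := by
    intro w
    rcases le_total 0 w with hw | hw
    · rw [abs_of_nonneg hw, hFneg, abs_neg]
      refine le_trans ?_ (mul_integral_Ioi_exp_neg_sq_half_le hw)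
      gcongr
      exact norm_integral_le_of_norm_le hei.integrableOn (Eventually.of_forall hub)
    · have key := mul_integral_Ioi_exp_neg_sq_half_le (w := -w) (by linarith)
      have hsym : ∫ y in Set.Ioi (-w), Real.exp (-y ^ 2 / 2) = ∫ y in Set.Iic w, e y := by
        rw [← integral_comp_neg_Iic]
        simp [he]
      rw [hsym, neg_sq] at key
      rw [abs_of_nonpos hw]
      refine le_trans ?_ key
      have : 0 ≤ -w := by linarith
      gcongr
      exact norm_integral_le_of_norm_le hei.integrableOn (Eventually.of_forall hub)
  have hee : ∀ w : ℝ, Real.exp (w ^ 2 / 2) * e w = 1 := fun w => by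
    simp only [he]; rw [← Real.exp_add]; ring_nf; simp
  have hwf : ∀ w, |w * (Real.exp (w ^ 2 / 2) * F w)| ≤ 1 := by
    intro w
    rw [abs_mul, abs_mul, Real.abs_exp]
    calc |w| * (Real.exp (w ^ 2 / 2) * |F w|) = Real.exp (w ^ 2 / 2) * (|w| * |F w|) := by ring
      _ ≤ Real.exp (w ^ 2 / 2) * e w := by gcongr; exact hFw w
      _ = 1 := hee w
  refine ⟨fun w => Real.exp (w ^ 2 / 2) * F w, fun w => ?_, fun w => ?_, hwf⟩
  · have hd : HasDerivAt (fun w : ℝ => Real.exp (w ^ 2 / 2)) (Real.exp (w ^ 2 / 2) * w) w := by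
      have h1 : HasDerivAt (fun y : ℝ => y ^ 2 / 2) w w := by
        have := (hasDerivAt_pow 2 w).div_const 2
        exact this.congr_deriv (by norm_num)
      exact h1.exp
    refine (hd.mul (hFd w)).congr_deriv ?_
    have : Real.exp (w ^ 2 / 2) * u w = h w - c := by
      simp only [hu]
      rw [mul_left_comm, hee, mul_one]
    rw [this]
    ring
  · rcases le_total |w| 1 with hw | hw
    · rw [abs_mul, Real.abs_exp]
      have hw2 : w ^ 2 ≤ 1 := by rw [← sq_abs]; exact pow_le_one₀ (abs_nonneg _) hw
      calc Real.exp (w ^ 2 / 2) * |F w| ≤ Real.exp (1 / 2) * ∫ y, e y := by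
            gcongr
            exact hFb w
        _ ≤ _ := by linarith
    · have h3 := hwf w
      rw [abs_mul] at h3
      have h4 : |Real.exp (w ^ 2 / 2) * F w| ≤ 1 :=
        le_trans (le_mul_of_one_le_left (abs_nonneg _) hw) h3
      have : 0 ≤ Real.exp (1 / 2) * ∫ y, e y := by positivity
      simp only
      linarith

/-! ### Preliminaries on the normal law and on independence -/

/-- The normal density is at most `1`. -/
lemma gaussianReal_real_Ioc_le (a b : ℝ) (hab : a ≤ b) :
    (gaussianReal 0 1).real (Set.Ioc a b) ≤ b - a := by
  have hle : ∀ x, gaussianPDFReal 0 1 x ≤ 1 := by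
    intro x
    simp only [gaussianPDFReal]
    have h1 : (Real.sqrt (2 * Real.pi * (1 : NNReal)))⁻¹ ≤ 1 := by
      refine inv_le_one_of_one_le₀ (Real.one_le_sqrt.2 ?_)
      have := Real.pi_gt_three
      simp
      linarith
    have h2 : Real.exp (-(x - 0) ^ 2 / (2 * (1 : NNReal))) ≤ 1 := by
      rw [Real.exp_le_one_iff]
      have := sq_nonneg (x - 0)
      simp at this ⊢
      linarith
    exact mul_le_one₀ h1 (Real.exp_pos _).le h2
  rw [measureReal_def, gaussianReal_apply_eq_integral 0 one_ne_zero,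
    ENNReal.toReal_ofReal (integral_nonneg fun x => gaussianPDFReal_nonneg 0 1 x)]
  calc ∫ x in Set.Ioc a b, gaussianPDFReal 0 1 x ≤ ∫ x in Set.Ioc a b, (1 : ℝ) :=
        integral_mono (integrable_gaussianPDFReal 0 1).integrableOn (by simp) hle
    _ = b - a := by simp [hab]

lemma integral_mul_comp_eq_zero {Ω : Type*} [MeasurableSpace Ω] {P : Measure Ω} {Y Z : Ω → ℝ}
    (hYm : Measurable Y) (hZm : Measurable Z) (hind : IndepFun Y Z P)
    (hY0 : ∫ ω, Y ω ∂P = 0) {f : ℝ → ℝ} (hf : Measurable f) : ∫ ω, Y ω * f (Z ω) ∂P = 0 := by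
  have := hind.integral_fun_comp_mul_comp (f := id) (g := f) hYm.aemeasurable hZm.aemeasurable
    measurable_id.aestronglyMeasurable hf.aestronglyMeasurable
  simp only [id] at this
  rw [this, hY0, zero_mul]

/-! ### Estimates for a single summand `Y` independent of the remainder `Z` -/

section IndependentPair

variable {Ω : Type*} [MeasurableSpace Ω] {P : Measure Ω} [IsProbabilityMeasure P] {Y Z : Ω → ℝ}

lemma measurableSet_lt_abs (hYm : Measurable Y) (ε : ℝ) : MeasurableSet {ω | ε < |Y ω|} :=
  measurableSet_lt measurable_const hYm.norm

lemma measurableSet_abs_sub_le (hYm : Measurable Y) (m ρ : ℝ) :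
    MeasurableSet {ω | |Y ω - m| ≤ ρ} :=
  measurableSet_le (hYm.sub_const m).norm measurable_const

/-- Chebyshev's association inequality for `Y ^ 2` and the indicator of `{|Y| > ε}`. -/
lemma integral_sq_mul_measureReal_le (hYm : Measurable Y) (hY : MemLp Y 2 P) {ε : ℝ} (hε : 0 ≤ ε) :
    (∫ ω, Y ω ^ 2 ∂P) * P.real {ω | ε < |Y ω|} ≤ ∫ ω in {ω | ε < |Y ω|}, Y ω ^ 2 ∂P := by
  set A := {ω | ε < |Y ω|} with hA
  have hAm : MeasurableSet A := measurableSet_lt_abs hYm ε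
  have hi := hY.integrable_sq
  -- With `p = P(A)`, and `a`, `b` the integrals of `Y ^ 2` over `A` and its complement: `a ≥ ε² p`
  -- and `b ≤ ε² (1 - p)` give `p b ≤ (1 - p) a`, that is `(a + b) p ≤ a`.
  have h1 : ε ^ 2 * P.real A ≤ ∫ ω in A, Y ω ^ 2 ∂P := by
    have := setIntegral_mono_on (μ := P) (s := A) (f := fun _ => ε ^ 2) (g := fun ω => Y ω ^ 2)
      (integrable_const _) hi.integrableOn hAm fun ω hω => by
        have : ε < |Y ω| := hω
        rw [← sq_abs (Y ω)]
        gcongr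
    simpa [mul_comm] using this
  have h2 : ∫ ω in Aᶜ, Y ω ^ 2 ∂P ≤ ε ^ 2 * (1 - P.real A) := by
    have := setIntegral_mono_on (μ := P) (s := Aᶜ) (f := fun ω => Y ω ^ 2) (g := fun _ => ε ^ 2)
      hi.integrableOn (integrable_const _) hAm.compl fun ω hω => by
        have : |Y ω| ≤ ε := not_lt.1 hω
        rw [← sq_abs (Y ω)]
        gcongr
    rw [← probReal_compl_eq_one_sub hAm]
    simpa [mul_comm] using this
  have h3 := integral_add_compl hAm hi
  have hp0 : 0 ≤ P.real A := measureReal_nonneg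
  have hp1 : P.real A ≤ 1 := measureReal_le_one
  rw [← h3]
  nlinarith

lemma MeasureTheory.MemLp.integrable_mul_comp_of_bounded (hY : MemLp Y 2 P) (hZm : Measurable Z)
    {f : ℝ → ℝ} (hf : Measurable f) {C : ℝ} (hC : ∀ w, |f w| ≤ C) :
    Integrable (fun ω => Y ω * f (Z ω)) P :=
  (hY.integrable one_le_two).mul_bdd (c := C) (hf.comp hZm).aestronglyMeasurable
    (Eventually.of_forall fun ω => hC (Z ω))

lemma abs_clamp_le {r : ℝ} (hr : 0 ≤ r) (x : ℝ) : |max (-r) (min r x)| ≤ r :=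
  abs_le.2 ⟨le_max_left _ _, max_le (by linarith) (min_le_left _ _)⟩

/-- Clamping is monotone. In the concentration argument this sign allows every event except the
favourable one to be discarded. -/
lemma mul_clamp_sub_clamp_nonneg (r z y : ℝ) :
    0 ≤ y * (max (-r) (min r (z + y)) - max (-r) (min r z)) := by
  rcases le_total 0 y with hy | hy
  · refine mul_nonneg hy (sub_nonneg.2 ?_)
    gcongr
    linarith
  · refine mul_nonneg_of_nonpos_of_nonpos hy (sub_nonpos.2 ?_)
    gcongr
    linarith

lemma clamp_eq_self {r x : ℝ} (hx : |x| ≤ r) : max (-r) (min r x) = x := by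
  rw [min_eq_right (abs_le.1 hx).2, max_eq_right (abs_le.1 hx).1]

/-- The contribution of one summand to the concentration inequality. -/
lemma integral_sq_mul_measureReal_sub_le_integral_mul_clamp (hYm : Measurable Y)
    (hZm : Measurable Z) (hY : MemLp Y 2 P) (hind : IndepFun Y Z P) (hY0 : ∫ ω, Y ω ∂P = 0)
    {ε : ℝ} (hε : 0 ≤ ε) (m : ℝ) {ρ : ℝ} (hρ : 0 ≤ ρ) :
    (∫ ω, Y ω ^ 2 ∂P) * P.real {ω | |Z ω + Y ω - m| ≤ ρ}
        - 2 * ∫ ω in {ω | ε < |Y ω|}, Y ω ^ 2 ∂P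
      ≤ ∫ ω, Y ω * max (-(ρ + 2 * ε)) (min (ρ + 2 * ε) (Z ω + Y ω - m)) ∂P := by
  -- If `|Z - m| ≤ ρ + ε` and `|Y| ≤ ε`, then `Z - m` and `Z + Y - m` both lie in `[-r, r]`, where
  -- the clamp is the identity, so its increment is exactly `Y`.
  set r := ρ + 2 * ε with hr
  have hr0 : 0 ≤ r := by positivity
  set A := {ω | ε < |Y ω|} with hA
  set B := {ω | |Z ω - m| ≤ ρ + ε} with hB
  set Q := {ω | |Z ω + Y ω - m| ≤ ρ} with hQ
  have hAm : MeasurableSet A := measurableSet_lt_abs hYm ε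
  have hBm : MeasurableSet B := measurableSet_abs_sub_le hZm m _
  set f : ℝ → ℝ := fun w => max (-r) (min r (w - m)) with hf
  have hfm : Measurable f := by simp only [hf]; fun_prop
  have hfb : ∀ w, |f w| ≤ r := fun w => abs_clamp_le hr0 _
  have hsq := hY.integrable_sq
  have hcross := integral_mul_comp_eq_zero hYm hZm hind hY0 hfm
  have hi1 : Integrable (fun ω => Y ω * f (Z ω + Y ω)) P :=
    hY.integrable_mul_comp_of_bounded (hZm.add hYm) hfm hfb
  have hi2 := hY.integrable_mul_comp_of_bounded hZm hfm hfb
  have hφm : Measurable ({y : ℝ | |y| ≤ ε}.indicator fun y => y ^ 2) :=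
    (by fun_prop : Measurable fun y : ℝ => y ^ 2).indicator
      (measurableSet_le measurable_norm measurable_const)
  have hψm : Measurable ({z : ℝ | |z - m| ≤ ρ + ε}.indicator fun _ => (1 : ℝ)) :=
    measurable_const.indicator (measurableSet_abs_sub_le measurable_id m _)
  have hprod := hind.integral_fun_comp_mul_comp hYm.aemeasurable hZm.aemeasurable
    hφm.aestronglyMeasurable hψm.aestronglyMeasurable
  have hφ : ∫ ω, {y : ℝ | |y| ≤ ε}.indicator (fun y => y ^ 2) (Y ω) ∂P
      = ∫ ω in Aᶜ, Y ω ^ 2 ∂P := by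
    rw [← integral_indicator hAm.compl]
    congr 1
    funext ω
    simp [Set.indicator, hA]
  have hψ : ∫ ω, {z : ℝ | |z - m| ≤ ρ + ε}.indicator (fun _ => (1 : ℝ)) (Z ω) ∂P = P.real B := by
    rw [← integral_indicator_one hBm]
    rfl
  rw [hφ, hψ] at hprod
  have hsplit := integral_add_compl hAm hsq
  -- Since `𝔼 Y f(Z) = 0`, the term `Y f(Z)` may be subtracted. The resulting integrand is
  -- nonnegative and equals `Y ^ 2` on the favourable event, whose contribution factors by
  -- independence.
  have hlower : (∫ ω in Aᶜ, Y ω ^ 2 ∂P) * P.real B ≤ ∫ ω, Y ω * f (Z ω + Y ω) ∂P := by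
    have heq : ∫ ω, Y ω * f (Z ω + Y ω) ∂P
        = ∫ ω, (Y ω * f (Z ω + Y ω) - Y ω * f (Z ω)) ∂P := by
      rw [integral_sub hi1 hi2, hcross, sub_zero]
    rw [heq, ← hprod]
    refine integral_mono_of_nonneg (Eventually.of_forall fun ω => ?_) (hi1.sub hi2)
      (Eventually.of_forall fun ω => ?_)
    · exact mul_nonneg (Set.indicator_nonneg (fun y _ => sq_nonneg y) _)
        (Set.indicator_nonneg (fun y _ => zero_le_one) _)
    · have hnn := mul_clamp_sub_clamp_nonneg r (Z ω - m) (Y ω)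
      rw [show Z ω - m + Y ω = Z ω + Y ω - m by ring, mul_sub] at hnn
      by_cases h1 : |Y ω| ≤ ε
      · by_cases h2 : |Z ω - m| ≤ ρ + ε
        · simp only [Set.indicator, Set.mem_ofPred_eq, h1, h2, if_true, hf, mul_one]
          rw [clamp_eq_self (x := Z ω - m) (by linarith), clamp_eq_self (x := Z ω + Y ω - m)]
          · exact le_of_eq (by ring)
          · rw [show Z ω + Y ω - m = (Z ω - m) + Y ω by ring]
            exact (abs_add_le _ _).trans (by linarith)
        · simpa [Set.indicator, h2, hf] using hnn
      · simpa [Set.indicator, h1, hf] using hnn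
  have hsub : Q ⊆ B ∪ A := by
    intro ω hω
    by_cases h1 : ω ∈ A
    · exact Or.inr h1
    · left
      have h1 : |Y ω| ≤ ε := not_lt.1 h1
      have h2 : |Z ω + Y ω - m| ≤ ρ := hω
      change |Z ω - m| ≤ ρ + ε
      rw [show Z ω - m = (Z ω + Y ω - m) - Y ω by ring]
      exact (abs_sub _ _).trans (by linarith)
  have hQle : P.real Q ≤ P.real B + P.real A :=
    (measureReal_mono hsub).trans (measureReal_union_le _ _)
  have hcheb := integral_sq_mul_measureReal_le hYm hY hε
  have hA0 : 0 ≤ ∫ ω in A, Y ω ^ 2 ∂P := integral_nonneg fun ω => sq_nonneg _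
  have hAc0 : 0 ≤ ∫ ω in Aᶜ, Y ω ^ 2 ∂P := integral_nonneg fun ω => sq_nonneg _
  have hQ1 : P.real Q ≤ 1 := measureReal_le_one
  have hPA : 0 ≤ P.real A := measureReal_nonneg
  -- Two losses of at most `∫_A Y²` each: one from replacing the second moment on `Aᶜ` by the full
  -- one, the other from `P(Q) ≤ P(B) + P(A)` and the association inequality.
  refine le_trans ?_ hlower
  rw [← hsplit] at hcheb ⊢
  nlinarith [mul_le_mul_of_nonneg_left hQle hAc0, mul_le_mul_of_nonneg_left hQ1 hA0,
    mul_nonneg hA0 hPA]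

/-- Taylor estimate with a local modulus `d` of continuity of the derivative on `[-ε, ε]`, and a
global bound otherwise. -/
lemma abs_sub_sub_mul_le {f g : ℝ → ℝ} (hfg : ∀ w, HasDerivAt f (g w) w) {M ε d z : ℝ}
    (hg : ∀ w, |g w| ≤ M) (hd : ∀ t, |t| ≤ ε → |g (z + t) - g z| ≤ d) (y : ℝ) :
    |f (z + y) - f z - y * g z| ≤ (if ε < |y| then 2 * M else d) * |y| := by
  -- The mean value inequality is applied to `t ↦ f (z + t) - t * g z`, whose derivative is the
  -- increment of `g`.
  have hder : ∀ t, HasDerivAt (fun t => f (z + t) - t * g z) (g (z + t) - g z) t := fun t => by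
    have h1 : HasDerivAt (fun t => f (z + t)) (g (z + t)) t := (hfg (z + t)).comp_const_add z t
    have h2 := (hasDerivAt_id t).mul_const (g z)
    rw [one_mul] at h2
    exact h1.sub h2
  have hrw : f (z + y) - f z - y * g z = (f (z + y) - y * g z) - (f (z + 0) - 0 * g z) := by
    simp; ring
  rw [hrw]
  split_ifs with hy
  · have := convex_univ.norm_image_sub_le_of_norm_hasDerivWithin_le (x := 0) (y := y) (C := 2 * M)
      (fun t _ => (hder t).hasDerivWithinAt) (fun t _ => ?_) (Set.mem_univ _) (Set.mem_univ _)
    · simpa using this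
    · exact (abs_sub _ _).trans (by linarith [hg (z + t), hg z])
  · rw [not_lt] at hy
    have := (convex_Icc (-ε) ε).norm_image_sub_le_of_norm_hasDerivWithin_le (x := 0) (y := y)
      (C := d) (fun t _ => (hder t).hasDerivWithinAt) (fun t ht => hd t (abs_le.2 ht))
      ⟨by linarith [abs_nonneg y], by linarith [abs_nonneg y]⟩ (abs_le.1 hy)
    simpa using this

/-- The contribution of one summand to the error in Stein's identity. -/
lemma abs_integral_mul_sub_le (hYm : Measurable Y) (hZm : Measurable Z) (hY : MemLp Y 2 P)
    (hind : IndepFun Y Z P) (hY0 : ∫ ω, Y ω ∂P = 0) {ε : ℝ} (hε : 0 ≤ ε) {f g D : ℝ → ℝ}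
    (hfg : ∀ w, HasDerivAt f (g w) w) (hgm : Measurable g) (hDm : Measurable D)
    {C : ℝ} (hC : ∀ w, |f w| ≤ C) (hg : ∀ w, |g w| ≤ 2)
    (hD : ∀ w t, |t| ≤ ε → |g (w + t) - g w| ≤ D w) (hDi : Integrable (fun ω => D (Z ω)) P) :
    |∫ ω, Y ω * f (Z ω + Y ω) ∂P - (∫ ω, Y ω ^ 2 ∂P) * ∫ ω, g (Z ω + Y ω) ∂P|
      ≤ 8 * ∫ ω in {ω | ε < |Y ω|}, Y ω ^ 2 ∂P + 2 * (∫ ω, Y ω ^ 2 ∂P) * ∫ ω, D (Z ω) ∂P := by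
  set A := {ω | ε < |Y ω|} with hA
  have hAm : MeasurableSet A := measurableSet_lt_abs hYm ε
  have hfm : Measurable f :=
    (continuous_iff_continuousAt.2 fun w => (hfg w).continuousAt).measurable
  have hD0 : ∀ w, 0 ≤ D w := fun w => (abs_nonneg _).trans (hD w 0 (by simpa using hε))
  have hsq := hY.integrable_sq
  have hcross := integral_mul_comp_eq_zero hYm hZm hind hY0 hfm
  have hi1 : Integrable (fun ω => Y ω * f (Z ω + Y ω)) P :=
    hY.integrable_mul_comp_of_bounded (hZm.add hYm) hfm hC
  have hi2 := hY.integrable_mul_comp_of_bounded hZm hfm hC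
  have hi12 : Integrable (fun ω => Y ω * f (Z ω + Y ω) - Y ω * f (Z ω)) P := hi1.sub hi2
  have hgZ : Integrable (fun ω => g (Z ω)) P :=
    Integrable.of_bound (hgm.comp hZm).aestronglyMeasurable 2 (Eventually.of_forall fun ω => hg _)
  have hgW : Integrable (fun ω => g (Z ω + Y ω)) P :=
    Integrable.of_bound (hgm.comp (hZm.add hYm)).aestronglyMeasurable 2
      (Eventually.of_forall fun ω => hg _)
  have hsqm : Measurable fun y : ℝ => y ^ 2 := by fun_prop
  have hind' : IndepFun (fun ω => Y ω ^ 2) (fun ω => D (Z ω)) P := hind.comp hsqm hDm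
  have hind'' : IndepFun (fun ω => Y ω ^ 2) (fun ω => g (Z ω)) P := hind.comp hsqm hgm
  have hi3 : Integrable (fun ω => Y ω ^ 2 * D (Z ω)) P := hind'.integrable_mul hsq hDi
  have hi4 : Integrable (fun ω => Y ω ^ 2 * g (Z ω)) P := hind''.integrable_mul hsq hgZ
  have hprodD : ∫ ω, Y ω ^ 2 * D (Z ω) ∂P = (∫ ω, Y ω ^ 2 ∂P) * ∫ ω, D (Z ω) ∂P :=
    hind'.integral_fun_mul_eq_mul_integral hsq.aestronglyMeasurable hDi.aestronglyMeasurable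
  have hprodg : ∫ ω, Y ω ^ 2 * g (Z ω) ∂P = (∫ ω, Y ω ^ 2 ∂P) * ∫ ω, g (Z ω) ∂P :=
    hind''.integral_fun_mul_eq_mul_integral hsq.aestronglyMeasurable hgZ.aestronglyMeasurable
  -- The Taylor expansion around `Z` produces `g(Z)`, which is independent of `Y`; `hstep2` then
  -- passes from `g(Z)` to `g(Z + Y)`. Each stage costs `4 ∫_A Y²` (in the second through the
  -- association inequality) and one copy of `𝔼 Y² · 𝔼 D(Z)`.
  have hstep1 : |∫ ω, Y ω * f (Z ω + Y ω) ∂P - (∫ ω, Y ω ^ 2 ∂P) * ∫ ω, g (Z ω) ∂P|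
      ≤ 4 * ∫ ω in A, Y ω ^ 2 ∂P + (∫ ω, Y ω ^ 2 ∂P) * ∫ ω, D (Z ω) ∂P := by
    have heq : ∫ ω, Y ω * f (Z ω + Y ω) ∂P - (∫ ω, Y ω ^ 2 ∂P) * ∫ ω, g (Z ω) ∂P
        = ∫ ω, (Y ω * f (Z ω + Y ω) - Y ω * f (Z ω) - Y ω ^ 2 * g (Z ω)) ∂P := by
      rw [integral_sub hi12 hi4, integral_sub hi1 hi2, hcross, hprodg, sub_zero]
    rw [heq, ← hprodD, ← integral_indicator hAm, ← integral_const_mul,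
      ← integral_add ((hsq.indicator hAm).const_mul 4) hi3]
    rw [← Real.norm_eq_abs]
    refine norm_integral_le_of_norm_le (((hsq.indicator hAm).const_mul 4).add hi3)
      (Eventually.of_forall fun ω => ?_)
    have h1 := abs_sub_sub_mul_le hfg hg (hD (Z ω)) (Y ω)
    rw [Real.norm_eq_abs, show Y ω * f (Z ω + Y ω) - Y ω * f (Z ω) - Y ω ^ 2 * g (Z ω)
      = Y ω * (f (Z ω + Y ω) - f (Z ω) - Y ω * g (Z ω)) by ring, abs_mul]
    have h2 := mul_le_mul_of_nonneg_left h1 (abs_nonneg (Y ω))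
    refine h2.trans ?_
    have h3 : |Y ω| * |Y ω| = Y ω ^ 2 := by rw [← sq, sq_abs]
    have h4 := mul_nonneg (sq_nonneg (Y ω)) (hD0 (Z ω))
    by_cases hω : ε < |Y ω|
    · rw [Set.indicator_of_mem (show ω ∈ A from hω), if_pos hω, mul_left_comm, h3]
      linarith
    · rw [Set.indicator_of_notMem (show ω ∉ A from hω), if_neg hω, mul_left_comm, h3]
      linarith
  have hstep2 : |∫ ω, g (Z ω) ∂P - ∫ ω, g (Z ω + Y ω) ∂P|
      ≤ 4 * P.real A + ∫ ω, D (Z ω) ∂P := by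
    have hAi : Integrable (A.indicator (1 : Ω → ℝ)) P := (integrable_const 1).indicator hAm
    rw [← integral_sub hgZ hgW, ← integral_indicator_one hAm, ← integral_const_mul,
      ← integral_add (hAi.const_mul 4) hDi]
    rw [← Real.norm_eq_abs]
    refine norm_integral_le_of_norm_le ((hAi.const_mul 4).add hDi)
      (Eventually.of_forall fun ω => ?_)
    rw [Real.norm_eq_abs]
    by_cases hω : ε < |Y ω|
    · rw [Set.indicator_of_mem (show ω ∈ A from hω)]
      refine (abs_sub _ _).trans ?_
      have := hD0 (Z ω)
      have h5 := hg (Z ω)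
      have h6 := hg (Z ω + Y ω)
      simp only [Pi.one_apply]
      linarith
    · rw [Set.indicator_of_notMem (show ω ∉ A from hω), abs_sub_comm]
      simpa using hD (Z ω) (Y ω) (not_lt.1 hω)
  have hcheb := integral_sq_mul_measureReal_le hYm hY hε
  have hs0 : 0 ≤ ∫ ω, Y ω ^ 2 ∂P := integral_nonneg fun ω => sq_nonneg _
  have htri : ∫ ω, Y ω * f (Z ω + Y ω) ∂P - (∫ ω, Y ω ^ 2 ∂P) * ∫ ω, g (Z ω + Y ω) ∂P
      = (∫ ω, Y ω * f (Z ω + Y ω) ∂P - (∫ ω, Y ω ^ 2 ∂P) * ∫ ω, g (Z ω) ∂P)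
        + (∫ ω, Y ω ^ 2 ∂P) * (∫ ω, g (Z ω) ∂P - ∫ ω, g (Z ω + Y ω) ∂P) := by ring
  rw [htri]
  refine (abs_add_le _ _).trans ?_
  rw [abs_mul, abs_of_nonneg hs0]
  have := mul_le_mul_of_nonneg_left hstep2 hs0
  nlinarith

end IndependentPair

/-! ### Concentration and Stein's identity for the sum of a row -/

section Row

variable {Ω : Type*} [MeasurableSpace Ω] {P : Measure Ω} [IsProbabilityMeasure P]

lemma integral_abs_le_one {Y : Ω → ℝ} (hY : MemLp Y 2 P) (h1 : ∫ ω, Y ω ^ 2 ∂P ≤ 1) :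
    ∫ ω, |Y ω| ∂P ≤ 1 := by
  have hY1 : Integrable Y P := hY.integrable one_le_two
  have h : ∫ ω, |Y ω| ∂P ≤ ∫ ω, (Y ω ^ 2 + 1) / 2 ∂P := by
    refine integral_mono hY1.abs ((hY.integrable_sq.add (integrable_const 1)).div_const 2) ?_
    intro ω
    have := sq_nonneg (|Y ω| - 1)
    have h2 := sq_abs (Y ω)
    simp only
    nlinarith
  rw [integral_div, integral_add hY.integrable_sq (integrable_const 1)] at h
  simp at h
  linarith

variable {ι : Type*} [Fintype ι] {X : ι → Ω → ℝ}

lemma integral_sum_sq (h2 : ∀ k, MemLp (X k) 2 P) (hind : iIndepFun X P)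
    (h0 : ∀ k, ∫ ω, X k ω ∂P = 0) :
    ∫ ω, (∑ k, X k ω) ^ 2 ∂P = ∑ k, ∫ ω, X k ω ^ 2 ∂P := by
  have hvar := IndepFun.variance_sum (s := Finset.univ) (fun k _ => h2 k)
    (fun i _ j _ hij => hind.indepFun hij)
  have hmean : ∫ ω, (∑ k, X k) ω ∂P = 0 := by
    simp only [Finset.sum_apply]
    rw [integral_finsetSum _ fun k _ => (h2 k).integrable one_le_two]
    exact Finset.sum_eq_zero fun k _ => h0 k
  rw [variance_of_integral_eq_zero
    (memLp_finsetSum' Finset.univ fun k _ => h2 k).aestronglyMeasurable.aemeasurable hmean] at hvar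
  simp only [Finset.sum_apply] at hvar
  rw [hvar]
  exact Finset.sum_congr rfl fun k _ =>
    variance_of_integral_eq_zero (h2 k).aestronglyMeasurable.aemeasurable (h0 k)

variable (hm : ∀ k, Measurable (X k)) (h2 : ∀ k, MemLp (X k) 2 P) (hind : iIndepFun X P)
  (h0 : ∀ k, ∫ ω, X k ω ∂P = 0) (hs : ∑ k, ∫ ω, X k ω ^ 2 ∂P = 1)

omit [IsProbabilityMeasure P] in
include hs in
lemma integral_sq_le_one (k : ι) : ∫ ω, X k ω ^ 2 ∂P ≤ 1 :=
  hs ▸ Finset.single_le_sum (f := fun k => ∫ ω, X k ω ^ 2 ∂P)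
    (fun _ _ => integral_nonneg fun _ => sq_nonneg _) (Finset.mem_univ k)

include h2 hind h0 hs in
lemma integral_abs_sum_le_one : ∫ ω, |∑ k, X k ω| ∂P ≤ 1 :=
  integral_abs_le_one (memLp_finsetSum Finset.univ fun k _ => h2 k)
    ((integral_sum_sq h2 hind h0).trans hs).le

omit [IsProbabilityMeasure P] in
include hm hind in
-- The difference is the sum over the other indices. Its form as a difference makes adding `X k`
-- back cancel directly.
lemma indepFun_sum_sub_self (k : ι) : IndepFun (X k) (fun ω => ∑ j, X j ω - X k ω) P := by
  classical
  have h := (hind.indepFun_finsetSum_of_notMem hm (Finset.notMem_erase k Finset.univ)).symm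
  convert h using 1
  funext ω
  rw [Finset.sum_apply, ← Finset.add_sum_erase _ _ (Finset.mem_univ k)]
  ring

include hm h2 hind h0 hs in
/-- Concentration inequality for the sum of a row. -/
lemma measureReal_abs_sum_sub_le {ε : ℝ} (hε : 0 ≤ ε) (m : ℝ) {ρ : ℝ} (hρ : 0 ≤ ρ) :
    P.real {ω | |∑ k, X k ω - m| ≤ ρ}
      ≤ ρ + 2 * ε + 2 * ∑ k, ∫ ω in {ω | ε < |X k ω|}, X k ω ^ 2 ∂P := by
  have hWm : Measurable fun ω => ∑ k, X k ω := Finset.measurable_fun_sum _ fun k _ => hm k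
  have hWi : Integrable (fun ω => ∑ k, X k ω) P :=
    integrable_finsetSum _ fun k _ => (h2 k).integrable one_le_two
  have hr0 : 0 ≤ ρ + 2 * ε := by positivity
  set f : ℝ → ℝ := fun w => max (-(ρ + 2 * ε)) (min (ρ + 2 * ε) (w - m)) with hf
  have hfm : Measurable f := by simp only [hf]; fun_prop
  have hfb : ∀ w, |f w| ≤ ρ + 2 * ε := fun w => abs_clamp_le hr0 _
  have hk : ∀ k, (∫ ω, X k ω ^ 2 ∂P) * P.real {ω | |∑ k, X k ω - m| ≤ ρ}
      - 2 * ∫ ω in {ω | ε < |X k ω|}, X k ω ^ 2 ∂P ≤ ∫ ω, X k ω * f (∑ k, X k ω) ∂P := by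
    intro k
    have := integral_sq_mul_measureReal_sub_le_integral_mul_clamp (hm k) (hWm.sub (hm k)) (h2 k)
      (indepFun_sum_sub_self hm hind k) (h0 k) hε m hρ
    simpa only [Pi.sub_apply, sub_add_cancel] using this
  have hsum := Finset.sum_le_sum fun k (_ : k ∈ Finset.univ) => hk k
  rw [Finset.sum_sub_distrib, ← Finset.sum_mul, ← Finset.mul_sum, hs, one_mul,
    ← integral_finsetSum _ fun k _ => (h2 k).integrable_mul_comp_of_bounded hWm hfm hfb] at hsum
  -- The sum over `k` is `W f(W)`, with `|f| ≤ ρ + 2ε` and `𝔼|W| ≤ 1` by the unit second moment.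
  have hupper : ∫ ω, ∑ k, X k ω * f (∑ k, X k ω) ∂P ≤ ρ + 2 * ε := by
    calc ∫ ω, ∑ k, X k ω * f (∑ k, X k ω) ∂P ≤ ∫ ω, (ρ + 2 * ε) * |∑ k, X k ω| ∂P := by
          refine integral_mono
            (integrable_finsetSum _ fun k _ =>
              (h2 k).integrable_mul_comp_of_bounded hWm hfm hfb) (hWi.abs.const_mul _) fun ω => ?_
          simp only
          rw [← Finset.sum_mul, mul_comm]
          refine (le_abs_self _).trans ?_
          rw [abs_mul]
          gcongr
          exact hfb _
      _ = (ρ + 2 * ε) * ∫ ω, |∑ k, X k ω| ∂P := integral_const_mul _ _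
      _ ≤ (ρ + 2 * ε) * 1 := by gcongr; exact integral_abs_sum_le_one h2 hind h0 hs
      _ = ρ + 2 * ε := mul_one _
  linarith

include hm h2 hind h0 hs in
/-- Error in Stein's identity for the sum of a row. The derivative `g` of the test function may
vary quickly near one point `m`. -/
lemma abs_integral_sum_mul_sub_le {ε : ℝ} (hε : 0 ≤ ε) {f g : ℝ → ℝ}
    (hfg : ∀ w, HasDerivAt f (g w) w) (hgm : Measurable g)
    {C : ℝ} (hC : ∀ w, |f w| ≤ C) (hg : ∀ w, |g w| ≤ 2) (m : ℝ)
    (hD : ∀ w t, |t| ≤ ε → |g (w + t) - g w|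
      ≤ ε * (C + 2 * |w|) + {w : ℝ | |w - m| ≤ 2 * ε}.indicator 1 w) :
    |∫ ω, (∑ k, X k ω) * f (∑ k, X k ω) ∂P - ∫ ω, g (∑ k, X k ω) ∂P|
      ≤ 14 * ∑ k, ∫ ω in {ω | ε < |X k ω|}, X k ω ^ 2 ∂P + (18 + 2 * C) * ε := by
  have hWm : Measurable fun ω => ∑ k, X k ω := Finset.measurable_fun_sum _ fun k _ => hm k
  have hWi : Integrable (fun ω => ∑ k, X k ω) P :=
    integrable_finsetSum _ fun k _ => (h2 k).integrable one_le_two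
  have hfm : Measurable f :=
    (continuous_iff_continuousAt.2 fun w => (hfg w).continuousAt).measurable
  set D : ℝ → ℝ := fun w => ε * (C + 2 * |w|) + {w : ℝ | |w - m| ≤ 2 * ε}.indicator 1 w with hDdef
  have hSm : MeasurableSet {w : ℝ | |w - m| ≤ 2 * ε} := measurableSet_abs_sub_le measurable_id m _
  have hDm : Measurable D := by
    have h1 : Measurable ({w : ℝ | |w - m| ≤ 2 * ε}.indicator (1 : ℝ → ℝ)) :=
      measurable_one.indicator hSm
    have h2 : Measurable fun w : ℝ => ε * (C + 2 * |w|) := by fun_prop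
    exact h2.add h1
  set L : ℝ := ∑ k, ∫ ω in {ω | ε < |X k ω|}, X k ω ^ 2 ∂P with hL
  -- Radius `3ε`, because `|Z - m| ≤ 2ε` forces `|W - m| ≤ 3ε` unless `|X k| > ε`.
  have hconc := measureReal_abs_sum_sub_le hm h2 hind h0 hs hε m (ρ := 3 * ε) (by positivity)
  -- Here `10 = 8 + 2`, where the `2` pays for the exceptional event `|X k| > ε` through the
  -- association inequality. The term `C + 4` comes from `𝔼|Z| ≤ 2`, and `5ε + 2L` is the
  -- concentration bound at radius `3ε`. Summed over `k` with total variance `1`, this gives `14 =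
  -- 10 + 4` and `18 + 2C = 2(C + 4) + 10`.
  have hk : ∀ k, |∫ ω, X k ω * f (∑ k, X k ω) ∂P
      - (∫ ω, X k ω ^ 2 ∂P) * ∫ ω, g (∑ k, X k ω) ∂P|
      ≤ 10 * ∫ ω in {ω | ε < |X k ω|}, X k ω ^ 2 ∂P
        + (∫ ω, X k ω ^ 2 ∂P) * (2 * (ε * (C + 4) + (5 * ε + 2 * L))) := by
    intro k
    set Z : Ω → ℝ := fun ω => ∑ j, X j ω - X k ω with hZ
    have hZm : Measurable Z := hWm.sub (hm k)
    have hXi := (h2 k).integrable one_le_two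
    have hZi : Integrable Z P := hWi.sub hXi
    have hZ1 : ∫ ω, |Z ω| ∂P ≤ 2 := by
      have h3 : ∫ ω, |Z ω| ∂P ≤ ∫ ω, (|∑ j, X j ω| + |X k ω|) ∂P :=
        integral_mono hZi.abs (hWi.abs.add hXi.abs) fun ω => abs_sub _ _
      rw [integral_add hWi.abs hXi.abs] at h3
      have h4 := integral_abs_sum_le_one h2 hind h0 hs
      have h5 := integral_abs_le_one (h2 k) (integral_sq_le_one hs k)
      linarith
    have hBm : MeasurableSet {ω | |Z ω - m| ≤ 2 * ε} := measurableSet_abs_sub_le hZm m _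
    have hBi : Integrable ({ω | |Z ω - m| ≤ 2 * ε}.indicator (1 : Ω → ℝ)) P :=
      (integrable_const 1).indicator hBm
    have hlin : Integrable (fun ω => ε * (C + 2 * |Z ω|)) P :=
      ((integrable_const C).add (hZi.abs.const_mul 2)).const_mul ε
    have hDi : Integrable (fun ω => D (Z ω)) P := hlin.add hBi
    have hDint : ∫ ω, D (Z ω) ∂P
        = ε * (C + 2 * ∫ ω, |Z ω| ∂P) + P.real {ω | |Z ω - m| ≤ 2 * ε} := by
      have : ∫ ω, D (Z ω) ∂P = ∫ ω, (ε * (C + 2 * |Z ω|)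
          + {ω | |Z ω - m| ≤ 2 * ε}.indicator (1 : Ω → ℝ) ω) ∂P := rfl
      rw [this, integral_add hlin hBi, integral_indicator_one hBm, integral_const_mul,
        integral_add (integrable_const C) (hZi.abs.const_mul 2), integral_const_mul]
      simp
    have hsub : {ω | |Z ω - m| ≤ 2 * ε} ⊆
        {ω | |∑ j, X j ω - m| ≤ 3 * ε} ∪ {ω | ε < |X k ω|} := by
      intro ω hω
      by_cases h1 : ε < |X k ω|
      · exact Or.inr h1
      · left
        have h3 : |Z ω - m| ≤ 2 * ε := hω
        change |∑ j, X j ω - m| ≤ 3 * ε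
        rw [show ∑ j, X j ω - m = (Z ω - m) + X k ω by simp only [hZ]; ring]
        exact (abs_add_le _ _).trans (by linarith)
    have hmeas := (measureReal_mono (μ := P) hsub).trans (measureReal_union_le _ _)
    have hcheb := integral_sq_mul_measureReal_le (hm k) (h2 k) hε
    have hσ : 0 ≤ ∫ ω, X k ω ^ 2 ∂P := integral_nonneg fun ω => sq_nonneg _
    have hDle : ∫ ω, D (Z ω) ∂P
        ≤ (ε * (C + 4) + (5 * ε + 2 * L)) + P.real {ω | ε < |X k ω|} := by
      rw [hDint]
      have h6 : ε * (C + 2 * ∫ ω, |Z ω| ∂P) ≤ ε * (C + 4) := by gcongr; linarith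
      linarith
    have key := abs_integral_mul_sub_le (hm k) hZm (h2 k) (indepFun_sum_sub_self hm hind k) (h0 k)
      hε hfg hgm hDm hC hg hD hDi
    simp only [hZ, sub_add_cancel] at key
    refine key.trans ?_
    have h7 := mul_le_mul_of_nonneg_left hDle hσ
    simp only [hZ] at h7
    linarith
  have hsum := (Finset.abs_sum_le_sum_abs _ _).trans
    (Finset.sum_le_sum fun k (_ : k ∈ Finset.univ) => hk k)
  rw [Finset.sum_sub_distrib, ← Finset.sum_mul, hs, one_mul, Finset.sum_add_distrib,
    ← Finset.mul_sum, ← Finset.sum_mul, hs, one_mul,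
    ← integral_finsetSum _ fun k _ => (h2 k).integrable_mul_comp_of_bounded hWm hfm hC] at hsum
  simp only [← Finset.sum_mul] at hsum
  refine hsum.trans (le_of_eq ?_)
  ring

end Row

/-! ### Smoothing of indicators and the uniform normal approximation -/

section SmoothedIndicator

/-- A continuous piecewise linear approximation, on the scale `ε`, of the indicator of `Iic x`. -/
noncomputable def smoothedIndicator (x ε : ℝ) : ℝ → ℝ := fun w => max 0 (min 1 ((x + ε - w) / ε))

lemma continuous_smoothedIndicator (x ε : ℝ) : Continuous (smoothedIndicator x ε) := by
  unfold smoothedIndicator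
  fun_prop

lemma smoothedIndicator_nonneg (x ε w : ℝ) : 0 ≤ smoothedIndicator x ε w := le_max_left _ _

lemma smoothedIndicator_le_one (x ε w : ℝ) : smoothedIndicator x ε w ≤ 1 :=
  max_le zero_le_one (min_le_left _ _)

lemma smoothedIndicator_eq_one {x ε w : ℝ} (hε : 0 < ε) (hw : w ≤ x) :
    smoothedIndicator x ε w = 1 := by
  have : 1 ≤ (x + ε - w) / ε := by rw [le_div_iff₀ hε]; linarith
  rw [smoothedIndicator, min_eq_left this, max_eq_right zero_le_one]

lemma smoothedIndicator_eq_zero {x ε w : ℝ} (hε : 0 < ε) (hw : x + ε ≤ w) :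
    smoothedIndicator x ε w = 0 := by
  have : (x + ε - w) / ε ≤ 0 := div_nonpos_of_nonpos_of_nonneg (by linarith) hε.le
  rw [smoothedIndicator, max_eq_left ((min_le_right _ _).trans this)]

/-- The ramp lives on `[x, x + ε]`, so a shift by at most `ε` starting farther than `2ε` from `x`
never meets its interior. Near `x` the trivial bound `1` replaces the useless Lipschitz constant
`1/ε`. -/
lemma abs_smoothedIndicator_add_sub_le {x ε : ℝ} (hε : 0 < ε) {t : ℝ} (ht : |t| ≤ ε) (w : ℝ) :
    |smoothedIndicator x ε (w + t) - smoothedIndicator x ε w|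
      ≤ {w : ℝ | |w - x| ≤ 2 * ε}.indicator 1 w := by
  by_cases hw : |w - x| ≤ 2 * ε
  · rw [Set.indicator_of_mem (show w ∈ {w : ℝ | |w - x| ≤ 2 * ε} from hw), abs_le]
    have h1 := smoothedIndicator_nonneg x ε (w + t)
    have h2 := smoothedIndicator_le_one x ε (w + t)
    have h3 := smoothedIndicator_nonneg x ε w
    have h4 := smoothedIndicator_le_one x ε w
    simp only [Pi.one_apply]
    constructor <;> linarith
  · rw [Set.indicator_of_notMem (show w ∉ {w : ℝ | |w - x| ≤ 2 * ε} from hw)]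
    obtain ⟨h1, h2⟩ := abs_le.1 ht
    rcases lt_abs.1 (not_le.1 hw) with h | h
    · rw [smoothedIndicator_eq_zero hε (by linarith), smoothedIndicator_eq_zero hε (by linarith)]
      simp
    · rw [smoothedIndicator_eq_one hε (by linarith), smoothedIndicator_eq_one hε (by linarith)]
      simp

/-- Normal approximation of a row for smoothed indicators, with an error linear in the Lindeberg
sum. -/
lemma exists_abs_integral_smoothedIndicator_sub_le : ∃ C : ℝ, 0 ≤ C ∧
    ∀ {Ω : Type*} [MeasurableSpace Ω] {P : Measure Ω} [IsProbabilityMeasure P]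
      {ι : Type*} [Fintype ι] {X : ι → Ω → ℝ}, (∀ k, Measurable (X k)) →
      (∀ k, MemLp (X k) 2 P) → iIndepFun X P → (∀ k, ∫ ω, X k ω ∂P = 0) →
      ∑ k, ∫ ω, X k ω ^ 2 ∂P = 1 → ∀ x ε : ℝ, 0 < ε →
      |∫ ω, smoothedIndicator x ε (∑ k, X k ω) ∂P
          - ∫ y, smoothedIndicator x ε y ∂(gaussianReal 0 1)|
        ≤ 14 * ∑ k, ∫ ω in {ω | ε < |X k ω|}, X k ω ^ 2 ∂P + C * ε := by
  obtain ⟨C, hC0, hstein⟩ := exists_stein_solution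
  refine ⟨18 + 2 * C, by positivity, ?_⟩
  intro Ω _ P _ ι _ X hm h2 hind h0 hs x ε hε
  set h := smoothedIndicator x ε with hh
  have hhc : Continuous h := continuous_smoothedIndicator x ε
  set c := ∫ y, h y ∂(gaussianReal 0 1) with hc
  obtain ⟨f, hfd, hfC, hf1⟩ := hstein h hhc (smoothedIndicator_nonneg x ε)
    (smoothedIndicator_le_one x ε)
  have hhi : Integrable h (gaussianReal 0 1) :=
    Integrable.of_bound hhc.aestronglyMeasurable 1 (Eventually.of_forall fun y => by
      rw [Real.norm_eq_abs, abs_of_nonneg (smoothedIndicator_nonneg x ε y)]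
      exact smoothedIndicator_le_one x ε y)
  have hc0 : 0 ≤ c := integral_nonneg (smoothedIndicator_nonneg x ε)
  have hc1 : c ≤ 1 := by
    have := integral_mono hhi (integrable_const (1 : ℝ)) (smoothedIndicator_le_one x ε)
    simpa using this
  have hfc : Continuous f := continuous_iff_continuousAt.2 fun w => (hfd w).continuousAt
  set g : ℝ → ℝ := fun w => w * f w + h w - c with hg
  have hgc : Continuous g := by simp only [hg]; fun_prop
  have hg2 : ∀ w, |g w| ≤ 2 := by
    intro w
    have h1 := abs_le.1 (hf1 w)
    have h3 : 0 ≤ h w := smoothedIndicator_nonneg x ε w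
    have h4 : h w ≤ 1 := smoothedIndicator_le_one x ε w
    simp only [hg]
    exact abs_le.2 ⟨by linarith, by linarith⟩
  have hflip : ∀ w t, |f (w + t) - f w| ≤ 2 * |t| := by
    intro w t
    have := convex_univ.norm_image_sub_le_of_norm_hasDerivWithin_le (x := w) (y := w + t) (C := 2)
      (fun t _ => (hfd t).hasDerivWithinAt) (fun t _ => hg2 t) (Set.mem_univ _) (Set.mem_univ _)
    simpa using this
  have hD : ∀ w t, |t| ≤ ε → |g (w + t) - g w|
      ≤ ε * (C + 2 * |w|) + {w : ℝ | |w - x| ≤ 2 * ε}.indicator 1 w := by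
    intro w t ht
    -- The bracket is the increment of `w * f w`, controlled by `|f| ≤ C` and the Lipschitz constant
    -- `2` of `f`; only the increment of `h` needs the indicator.
    have hrw : g (w + t) - g w
        = (t * f (w + t) + w * (f (w + t) - f w)) + (h (w + t) - h w) := by
      simp only [hg]; ring
    rw [hrw]
    refine (abs_add_le _ _).trans (add_le_add ((abs_add_le _ _).trans ?_)
      (abs_smoothedIndicator_add_sub_le hε ht w))
    rw [abs_mul, abs_mul]
    have h1 : |t| * |f (w + t)| ≤ ε * C := by gcongr; exact hfC _
    have h3 : |w| * |f (w + t) - f w| ≤ |w| * (2 * ε) := by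
      gcongr
      exact (hflip w t).trans (by linarith)
    linarith
  have key := abs_integral_sum_mul_sub_le hm h2 hind h0 hs hε.le hfd hgc.measurable hfC hg2 x hD
  have hWm : Measurable fun ω => ∑ k, X k ω := Finset.measurable_fun_sum _ fun k _ => hm k
  have hW2 : MemLp (fun ω => ∑ k, X k ω) 2 P := memLp_finsetSum Finset.univ fun k _ => h2 k
  have hWf := hW2.integrable_mul_comp_of_bounded hWm hfc.measurable hfC
  have hhW : Integrable (fun ω => h (∑ k, X k ω)) P :=
    Integrable.of_bound (hhc.measurable.comp hWm).aestronglyMeasurable 1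
      (Eventually.of_forall fun ω => by
        rw [Real.norm_eq_abs, abs_of_nonneg (smoothedIndicator_nonneg x ε _)]
        exact smoothedIndicator_le_one x ε _)
  have hgint : ∫ ω, g (∑ k, X k ω) ∂P = ∫ ω, (∑ k, X k ω) * f (∑ k, X k ω) ∂P
      + ∫ ω, h (∑ k, X k ω) ∂P - c := by
    have hadd : Integrable (fun ω => (∑ k, X k ω) * f (∑ k, X k ω) + h (∑ k, X k ω)) P :=
      hWf.add hhW
    simp only [hg]
    rw [integral_sub hadd (integrable_const c), integral_add hWf hhW]
    simp
  rw [hgint, abs_sub_comm] at key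
  convert key using 2
  ring

lemma measureReal_le_integral_smoothedIndicator (μ : Measure ℝ) [IsProbabilityMeasure μ]
    {x ε : ℝ} (hε : 0 < ε) :
    μ.real (Set.Iic x) ≤ ∫ y, smoothedIndicator x ε y ∂μ ∧
      ∫ y, smoothedIndicator x ε y ∂μ ≤ μ.real (Set.Iic (x + ε)) := by
  have hi : Integrable (smoothedIndicator x ε) μ :=
    Integrable.of_bound (continuous_smoothedIndicator x ε).aestronglyMeasurable 1
      (Eventually.of_forall fun y => by
        rw [Real.norm_eq_abs, abs_of_nonneg (smoothedIndicator_nonneg x ε y)]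
        exact smoothedIndicator_le_one x ε y)
  rw [← integral_indicator_one measurableSet_Iic, ← integral_indicator_one measurableSet_Iic]
  refine ⟨integral_mono ((integrable_const 1).indicator measurableSet_Iic) hi fun y => ?_,
    integral_mono hi ((integrable_const 1).indicator measurableSet_Iic) fun y => ?_⟩
  · refine Set.indicator_le' (fun y hy => ?_) (fun y _ => smoothedIndicator_nonneg x ε y) y
    rw [smoothedIndicator_eq_one hε hy, Pi.one_apply]
  · refine Set.le_indicator (fun y _ => smoothedIndicator_le_one x ε y) (fun y hy => ?_) y
    exact (smoothedIndicator_eq_zero hε (not_le.1 hy).le).le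

lemma gaussianReal_real_Iic_add_le (x : ℝ) {ε : ℝ} (hε : 0 ≤ ε) :
    (gaussianReal 0 1).real (Set.Iic (x + ε)) ≤ (gaussianReal 0 1).real (Set.Iic x) + ε := by
  rw [← Set.Iic_union_Ioc_eq_Iic (show x ≤ x + ε by linarith)]
  refine (measureReal_union_le _ _).trans ?_
  have := gaussianReal_real_Ioc_le x (x + ε) (by linarith)
  linarith

/-- Uniform normal approximation of the sum of a row (an inequality of Osipov type). -/
lemma exists_abs_measureReal_sub_le : ∃ C : ℝ, 0 ≤ C ∧
    ∀ {Ω : Type*} [MeasurableSpace Ω] {P : Measure Ω} [IsProbabilityMeasure P]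
      {ι : Type*} [Fintype ι] {X : ι → Ω → ℝ}, (∀ k, Measurable (X k)) →
      (∀ k, MemLp (X k) 2 P) → iIndepFun X P → (∀ k, ∫ ω, X k ω ∂P = 0) →
      ∑ k, ∫ ω, X k ω ^ 2 ∂P = 1 → ∀ x ε : ℝ, 0 < ε →
      |(gaussianReal 0 1).real (Set.Iic x) - P.real {ω | ∑ k, X k ω ≤ x}|
        ≤ 14 * ∑ k, ∫ ω in {ω | ε < |X k ω|}, X k ω ^ 2 ∂P + C * ε := by
  obtain ⟨C, hC0, hC⟩ := exists_abs_integral_smoothedIndicator_sub_le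
  refine ⟨C + 1, by positivity, ?_⟩
  intro Ω _ P _ ι _ X hm h2 hind h0 hs x ε hε
  have hWm : Measurable fun ω => ∑ k, X k ω := Finset.measurable_fun_sum _ fun k _ => hm k
  have hmap : ∀ a, ∫ y, smoothedIndicator a ε y ∂(P.map fun ω => ∑ k, X k ω)
      = ∫ ω, smoothedIndicator a ε (∑ k, X k ω) ∂P := fun a =>
    integral_map hWm.aemeasurable (continuous_smoothedIndicator a ε).aestronglyMeasurable
  have hmapIic : (P.map fun ω => ∑ k, X k ω).real (Set.Iic x) = P.real {ω | ∑ k, X k ω ≤ x} :=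
    map_measureReal_apply hWm measurableSet_Iic
  have := Measure.isProbabilityMeasure_map (μ := P) hWm.aemeasurable
  -- The ramp starting at `x` bounds the distribution function of the sum from above, the one
  -- starting at `x - ε` from below. Each costs a further normal mass of at most `ε`, whence `C +
  -- 1`.
  have hup := abs_le.1 (hC hm h2 hind h0 hs x ε hε)
  have hlow := abs_le.1 (hC hm h2 hind h0 hs (x - ε) ε hε)
  have hW1 := (measureReal_le_integral_smoothedIndicator
    (P.map fun ω => ∑ k, X k ω) (x := x) hε).1
  have hW2 := (measureReal_le_integral_smoothedIndicator
    (P.map fun ω => ∑ k, X k ω) (x := x - ε) hε).2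
  have hN1 := (measureReal_le_integral_smoothedIndicator (gaussianReal 0 1) (x := x) hε).2
  have hN2 := (measureReal_le_integral_smoothedIndicator (gaussianReal 0 1) (x := x - ε) hε).1
  have hG1 := gaussianReal_real_Iic_add_le x hε.le
  have hG2 := gaussianReal_real_Iic_add_le (x - ε) hε.le
  rw [hmap, hmapIic] at hW1
  rw [hmap, sub_add_cancel, hmapIic] at hW2
  rw [sub_add_cancel] at hG2
  rw [add_mul, one_mul]
  exact abs_le.2 ⟨by linarith [hup.2], by linarith [hlow.1]⟩

end SmoothedIndicator

/-! ### Passage to the limit -/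

lemma lindebergSum_nonneg {Ω : Type*} [MeasurableSpace Ω] (P : Measure Ω)
    (X : (n : ℕ) → Fin n → Ω → ℝ) (ε : ℝ) (n : ℕ) : 0 ≤ lindebergSum P X ε n :=
  Finset.sum_nonneg fun _ _ => integral_nonneg fun _ => sq_nonneg _

lemma IsStandardTriangularArray.lindebergSum_le_one {Ω : Type*} [MeasurableSpace Ω] {P : Measure Ω}
    {X : (n : ℕ) → Fin n → Ω → ℝ} (hX : IsStandardTriangularArray P X) (ε : ℝ) {n : ℕ}
    (hn : 1 ≤ n) : lindebergSum P X ε n ≤ 1 := by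
  rw [← hX.sum_second_moment n hn]
  exact Finset.sum_le_sum fun k _ => setIntegral_le_integral (hX.memLp_two n k).integrable_sq
    (Eventually.of_forall fun _ => sq_nonneg _)

/-- The uniform bound `1` is essential: a real-valued supremum of an unbounded family would take the
default value `0`. Row `0` carries no condition on its second moments, so the bound on the sums is
taken from `n = 1` on. -/
lemma IsStandardTriangularArray.limsup_lindebergSum_le_lindebergIndex {Ω : Type*}
    [MeasurableSpace Ω] {P : Measure Ω} {X : (n : ℕ) → Fin n → Ω → ℝ}
    (hX : IsStandardTriangularArray P X) {ε : ℝ} (hε : 0 < ε) :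
    limsup (fun n => lindebergSum P X ε n) atTop ≤ lindebergIndex P X := by
  refine le_ciSup (f := fun ε : {ε : ℝ // 0 < ε} => limsup (fun n => lindebergSum P X ε n) atTop)
    ⟨1, ?_⟩ ⟨ε, hε⟩
  rintro _ ⟨δ, rfl⟩
  refine limsup_le_of_le ?_ ?_
  · exact isCoboundedUnder_le_of_le atTop fun n => lindebergSum_nonneg P X δ n
  · filter_upwards [eventually_ge_atTop 1] with n hn using hX.lindebergSum_le_one δ hn

theorem theorem1p4 :
    ∃ C : ℝ, 0 < C ∧
      ∀ (Ω : Type*) [MeasurableSpace Ω] (P : Measure Ω) [IsProbabilityMeasure P]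
        (ξ : Ω → ℝ), HasLaw ξ (gaussianReal 0 1) P →
        ∀ X : (n : ℕ) → Fin n → Ω → ℝ, IsStandardTriangularArray P X →
          lambdaK P X ξ ≤ C * lindebergIndex P X := by
  obtain ⟨C, hC0, hC⟩ := exists_abs_measureReal_sub_le
  -- The constant `C` multiplies only `ε` and disappears in the limit.
  refine ⟨14, by norm_num, ?_⟩
  intro Ω _ P _ ξ hξ X hX
  have hlaw : ∀ x, P.real {ω | ξ ω ≤ x} = (gaussianReal 0 1).real (Set.Iic x) := by
    intro x
    rw [← hξ.map_eq, measureReal_def, measureReal_def,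
      Measure.map_apply_of_aemeasurable hξ.aemeasurable measurableSet_Iic]
    rfl
  have hdist : ∀ ε : ℝ, 0 < ε → ∀ n : ℕ, 1 ≤ n →
      kolmogorovDist P ξ (rowSum X n) ≤ 14 * lindebergSum P X ε n + C * ε := by
    intro ε hε n hn
    refine ciSup_le fun x => ?_
    rw [hlaw]
    exact hC (hX.measurable n) (hX.memLp_two n) (hX.indep n hn) (hX.mean_zero n)
      (hX.sum_second_moment n hn) x ε hε
  have hbound : ∀ ε : ℝ, 0 < ε → lambdaK P X ξ ≤ 14 * (lindebergIndex P X + ε) + C * ε := by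
    intro ε hε
    refine limsup_le_of_le ?_ ?_
    · exact isCoboundedUnder_le_of_le atTop fun n => Real.iSup_nonneg fun x => abs_nonneg _
    · have hlt : limsup (fun n => lindebergSum P X ε n) atTop < lindebergIndex P X + ε :=
        (hX.limsup_lindebergSum_le_lindebergIndex hε).trans_lt (lt_add_of_pos_right _ hε)
      have hbdd : IsBoundedUnder (· ≤ ·) atTop fun n => lindebergSum P X ε n :=
        isBoundedUnder_of_eventually_le (a := 1) (by
          filter_upwards [eventually_ge_atTop 1] with n hn using hX.lindebergSum_le_one ε hn)
      filter_upwards [eventually_lt_of_limsup_lt hlt hbdd, eventually_ge_atTop 1] with n h1 hn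
      have := hdist ε hε n hn
      linarith
  refine le_of_forall_pos_le_add fun δ hδ => ?_
  -- The total excess over `14` times the index is `(14 + C) ε`, which this choice of `ε` makes
  -- equal to `δ`.
  have h := hbound (δ / (14 + C)) (by positivity)
  have hcancel : (14 + C) * (δ / (14 + C)) = δ := by field_simp
  linarith
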